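/- A server holding a library of $m$ files of equal size is connected to $n$ users by a shared noiseless multicast link. Scalar uniform placement (SUP): every user, independently of the others, caches $M$ entire files ($M$ an integer), the set of cached files being uniformly distributed among all $M$-subsets of the library; let $C_u$ be the set of files cached by user $u$. Afterwards each user requests $L$ distinct files (different users may request the same file), the requests of all users being drawn from an arbitrary joint law that does not depend on the cache contents. Delivery uses Greedy Constrained Local Coloring (GCLC) at file level ($B=1$ packet per file). The conflict graph has one vertex $v$ for each pair of a user $\mu(v)$ and a file $\rho(v)$ requested by that user, and a directed edge from $v_2$ to $v_1$ whenever $\rho(v_1)\notin C_{\mu(v_2)}$ and $\rho(v_1)\ne\rho(v_2)$. Two vertices are adjacent if there is an edge between them in at least one direction. The label of $v$ is the set of users $\{\mu(v)\}\cup\{u:\rho(v)\in C_u\}$. The greedy constrained coloring repeats, until every vertex is colored: pick any uncolored vertex $v$, scan the other uncolored vertices in any order, collecting each one that has the same label as $v$ and is not adjacent to $v$ or to any vertex collected so far, and give $v$ and the collected vertices a new color. For a coloring $c$, its local number of colors is $\max_v |c(\mathcal N^+(v))|$, where $\mathcal N^+(v)$ consists of $v$ and its out-neighbors. GCLC takes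 the smaller of the local numbers of colors of two colorings, the greedy constrained one and the one that colors each vertex $v$ by its file $\rho(v)$; this is the number of file transmissions. The rate $R^{\text{SUP-GCLC}}$ is, for given cache contents, the mean over the requests of the number of file transmissions. Theorem. Let $n,m,M,L\to\infty$ along a sequence with $M<m$ (eventually), $M=\omega(L)$, and $L=\omega(g)$, where $$g=\frac{nM}{m}\Big(\frac mM\Big)^n\frac1{1-M/m}\ \text{ if } \frac Mm<\frac12,\qquad g=n\Big(\frac m{m-M}\Big)^n\ \text{ if } \frac Mm\ge\frac12 .$$ Then $$R^{\text{SUP-GCLC}}\le(1+o(1))\min\Big\{L\Big(\frac mM-1\Big),\,Ln,\,m-M\Big\},$$ both for the mean of $R^{\text{SUP-GCLC}}$ over the random placement and with probability $1-o(1)$ over the random placement. The $o(1)$ terms depend only on the sequences $n,m,M,L$: they are uniform over the law of the requests and over the arbitrary choices made by the greedy coloring. -/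

import Mathlib

open Filter Topology Asymptotics

namespace SharedLink

/-- The cache configurations of `n` users when each of them stores `M` entire files out of a
library of `m` files. Scalar uniform placement is the uniform distribution on this finite set,
that is, the users draw their `M`-subsets of the library independently and uniformly. -/
abbrev Placement (n m M : ℕ) : Type :=
  Fin n → {s : Finset (Fin m) // s.card = M}

/-- The request matrices in which every user requests `L` distinct files
(different users may request the same file). -/
abbrev Demand (n m L : ℕ) : Type :=
  Fin n → (Fin L ↪ Fin m)

/-- The mean of a real function of the cache configuration under scalar uniform placement. -/
noncomputable def placementMean {n m M : ℕ} (g : Placement n m M → ℝ) : ℝ :=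
  (∑ C, g C) / Fintype.card (Placement n m M)

open Classical in
/-- The probability of a property of the cache configuration under scalar uniform placement. -/
noncomputable def placementProb {n m M : ℕ} (E : Placement n m M → Prop) : ℝ :=
  ((Finset.univ.filter E).card : ℝ) / Fintype.card (Placement n m M)

/-- The vertices of the conflict graph for `B = 1`: one for each packet (= file) requested by each
user. The vertex `(u, l)` is the `l`-th request of user `u`; as the requests of a user are distinct,
a vertex is determined by its packet and its user. -/
abbrev Vertex (n L : ℕ) : Type := Fin n × Fin L

/-- The packet of a vertex. -/
def packet {n m L : ℕ} (d : Demand n m L) (v : Vertex n L) : Fin m := d v.1 v.2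

/-- The user requesting a vertex. -/
def user {n L : ℕ} (v : Vertex n L) : Fin n := v.1

/-- `v₁` interferes with `v₂`: its packet is not in the cache of the user of `v₂`, and the two
vertices do not represent the same packet. -/
def Interferes {n m M L : ℕ} (C : Placement n m M) (d : Demand n m L) (v₁ v₂ : Vertex n L) : Prop :=
  packet d v₁ ∉ (C (user v₂)).1 ∧ packet d v₁ ≠ packet d v₂

/-- The directed conflict graph: an edge from `v₂` to `v₁` whenever `v₁` interferes with `v₂`. -/
def conflictGraph {n m M L : ℕ} (C : Placement n m M) (d : Demand n m L) :
    Digraph (Vertex n L) where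
  Adj v₂ v₁ := Interferes C d v₁ v₂

/-- The user label of a vertex: the user that requests it together with all the users
that have its packet in their caches. -/
def userLabel {n m M L : ℕ} (C : Placement n m M) (d : Demand n m L) (v : Vertex n L) :
    Finset (Fin n) :=
  insert (user v) (Finset.univ.filter fun u => packet d v ∈ (C u).1)

open Classical in
/-- The closed out-neighbourhood of a vertex of a directed graph. -/
noncomputable def closedOutNbhd {V : Type*} [Fintype V] (H : Digraph V) (v : V) : Finset V :=
  Finset.univ.filter fun w => w = v ∨ H.Adj v w

open Classical in
/-- The local number of colors of a coloring `c`: the maximum over the vertices of the number of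
colors in the closed out-neighbourhood. -/
noncomputable def localColors {V κ : Type*} [Fintype V] (H : Digraph V) (c : V → κ) : ℕ :=
  Finset.univ.sup fun v => ((closedOutNbhd H v).image c).card

open Classical in
/-- Starting from `{v}`, scan the vertices of the list `σ` in order, and add each one that has the
same label as `v` and that is not adjacent to any vertex collected so far. -/
noncomputable def greedyScan {V κ : Type*} (G : SimpleGraph V) (label : V → κ) (v : V)
    (σ : List V) : Finset V :=
  σ.foldl (fun I w => if label w = label v ∧ ∀ x ∈ I, ¬ G.Adj x w then insert w I else I) {v}

/-- The runs of greedy constrained coloring. `GreedyRun G label R cls` says that `cls` is a list of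
color classes which the procedure can produce when the set of vertices still to be colored is `R`:
while `R` is non-empty, pick any vertex `v` of `R`, scan the other vertices of `R` in any order to
form the color class of `v`, give that class a new color, and remove it from `R`. -/
inductive GreedyRun {V κ : Type*} [DecidableEq V] (G : SimpleGraph V) (label : V → κ) :
    Finset V → List (Finset V) → Prop
  | done : GreedyRun G label ∅ []
  | step (R : Finset V) (v : V) (σ : List V) (cls : List (Finset V)) (hv : v ∈ R)
      (hσ : ∀ w, w ∈ σ ↔ w ∈ R.erase v)
      (hrest : GreedyRun G label (R \ greedyScan G label v σ) cls) :
      GreedyRun G label R (greedyScan G label v σ :: cls)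

/-- The coloring given by a list of color classes: the color of a vertex is the index of its
class. -/
def colorOf {V : Type*} [DecidableEq V] (cls : List (Finset V)) (v : V) : ℕ :=
  cls.findIdx fun I => decide (v ∈ I)

/-- `cls` is a list of color classes that greedy constrained coloring can produce on the
conflict graph: only vertices with the same user label can share a color. -/
def IsConstrainedColoring {n m M L : ℕ} (C : Placement n m M) (d : Demand n m L)
    (cls : List (Finset (Vertex n L))) : Prop :=
  GreedyRun (conflictGraph C d).toSimpleGraphInclusive (userLabel C d) Finset.univ cls

/-- The number of file transmissions of Greedy Constrained Local Coloring: the smaller of the local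
numbers of colors of two colorings of the conflict graph, the greedy constrained one (with color
classes `cls`) and the one in which the color of a vertex is its packet. -/
noncomputable def gclc {n m M L : ℕ} (C : Placement n m M) (d : Demand n m L)
    (cls : List (Finset (Vertex n L))) : ℕ :=
  min (localColors (conflictGraph C d) (colorOf cls))
    (localColors (conflictGraph C d) (packet d))

/-- The rate of GCLC delivery for the cache configuration `C`: the mean number of file
transmissions when the request matrix has law `Q`. The greedy choices are made by `run`. -/
noncomputable def gclcRate {n m M L : ℕ} (Q : PMF (Demand n m L))
    (run : Placement n m M → Demand n m L → List (Finset (Vertex n L)))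
    (C : Placement n m M) : ℝ :=
  ∑ d, (Q d).toReal * (gclc C d (run C d) : ℝ)

end SharedLink

/-! Write `p = M / m`. Only the constrained coloring is analysed, and its local number of colors is
bounded by its total number of colors. Two vertices with the same label `S` and different users are
never adjacent, since each user caches the packet of the other. For one user they form a complete
multipartite graph: every missing packet is a part, and all cached packets together are one part. A
greedy class is a maximal independent set, so it takes a whole part from each user still present.
Label `S` therefore costs at most the largest number of parts of a user, which is at most one plus a
pattern count (`GreedyRun.length_le`, `card_slots_le`).

For `u ∈ S` the count of requests of `u` cached exactly by `S \ {u}` has a generating function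
dominated by that of a binomial variable with mean `L * q S`, where `q S = p ^ (|S| - 1) * (1 - p) ^
(n - |S| + 1)`. The sum of `q S` over nonempty `S` is at most `(1 - p) / p = m / M - 1`, which gives
the main term. The growth condition says that each `L * q S` exceeds any fixed multiple of `n`, so
Chernoff bounds survive a sum over fewer than `2 ^ n * n` pairs, and the cost of one extra color per
label is negligible (`gclcRate_bounds`).

All estimates hold for each fixed demand, hence after averaging over any law of demands. The bound
`L * n` is the number of vertices; `m - M` dominates the main term once `L ≤ M`. -/

namespace SharedLink

/-! ### Number of classes of a greedy constrained coloring. -/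

section Greedy

variable {V κ U τ : Type*} (G : SimpleGraph V) (label : V → κ)

lemma mem_greedyScan_self (v : V) (σ : List V) : v ∈ greedyScan G label v σ := by
  classical
  unfold greedyScan
  suffices H : ∀ (σ : List V) (I : Finset V), v ∈ I → v ∈ σ.foldl (fun I w =>
      if label w = label v ∧ ∀ x ∈ I, ¬ G.Adj x w then insert w I else I) I by
    convert H σ {v} (by simp)
  intro σ
  induction σ with
  | nil => intro I h; simpa using h
  | cons a σ ih =>
    intro I h
    rw [List.foldl_cons]
    apply ih
    split_ifs
    · exact Finset.mem_insert_of_mem h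
    · exact h

/-- The class collected by a greedy scan is contained in the scanned part of the label of `v`, is
independent, and is maximal with these properties. -/
lemma greedyScan_spec (v : V) (σ : List V) :
    (∀ w ∈ greedyScan G label v σ, w = v ∨ w ∈ σ) ∧
    (∀ w ∈ greedyScan G label v σ, label w = label v) ∧
    (∀ x ∈ greedyScan G label v σ, ∀ y ∈ greedyScan G label v σ, ¬ G.Adj x y) ∧
    ∀ w ∈ σ, label w = label v → (∀ x ∈ greedyScan G label v σ, ¬ G.Adj x w) →
      w ∈ greedyScan G label v σ := by
  classical
  unfold greedyScan
  suffices H : ∀ (σ : List V) (I : Finset V), (∀ w ∈ I, label w = label v) →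
      (∀ x ∈ I, ∀ y ∈ I, ¬ G.Adj x y) → ∀ J, J = σ.foldl (fun I w =>
      if label w = label v ∧ ∀ x ∈ I, ¬ G.Adj x w then insert w I else I) I →
      I ⊆ J ∧ (∀ w ∈ J, w ∈ I ∨ w ∈ σ) ∧ (∀ w ∈ J, label w = label v) ∧
      (∀ x ∈ J, ∀ y ∈ J, ¬ G.Adj x y) ∧
      ∀ w ∈ σ, label w = label v → (∀ x ∈ J, ¬ G.Adj x w) → w ∈ J by
    simpa only [Finset.mem_singleton] using (H σ {v} (by simp) (by simp) _ rfl).2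
  intro σ
  induction σ with
  | nil => rintro I h1 h2 J rfl; simpa using And.intro h1 h2
  | cons a σ ih =>
    intro I h1 h2 J hJ
    rw [List.foldl_cons] at hJ
    by_cases ha : label a = label v ∧ ∀ x ∈ I, ¬ G.Adj x a
    · rw [if_pos ha] at hJ
      obtain ⟨k0, k4, k1, k2, k3⟩ := ih (insert a I) (by simpa using ⟨ha.1, h1⟩)
        (by
          intro x hx y hy
          rw [Finset.mem_insert] at hx hy
          rcases hx with rfl | hx <;> rcases hy with rfl | hy
          · exact G.irrefl
          · exact fun h => ha.2 y hy h.symm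
          · exact ha.2 x hx
          · exact h2 x hx y hy) J hJ
      refine ⟨(Finset.subset_insert _ _).trans k0, fun w hw => ?_, k1, k2, ?_⟩
      · rcases k4 w hw with hw | hw
        · rcases Finset.mem_insert.1 hw with rfl | hw
          · exact Or.inr List.mem_cons_self
          · exact Or.inl hw
        · exact Or.inr (List.mem_cons_of_mem _ hw)
      intro w hw hl hadj
      rcases List.mem_cons.1 hw with rfl | hw
      · exact k0 (Finset.mem_insert_self _ _)
      · exact k3 w hw hl hadj
    · rw [if_neg ha] at hJ
      obtain ⟨k0, k4, k1, k2, k3⟩ := ih I h1 h2 J hJ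
      refine ⟨k0, fun w hw => (k4 w hw).imp_right (List.mem_cons_of_mem _), k1, k2, ?_⟩
      intro w hw hl hadj
      rcases List.mem_cons.1 hw with rfl | hw
      -- A vertex with the right label is rejected only for a conflict with the class so far, and
      -- this conflict persists as the class grows.
      · exact absurd ⟨hl, fun x hx => hadj x (k0 hx)⟩ ha
      · exact k3 w hw hl hadj

open Classical in
/-- The slots taken by the vertices of `R` that have label `S` and owner `u`. -/
noncomputable def slots (label : V → κ) (owner : V → U) (slot : V → τ) (R : Finset V)
    (S : κ) (u : U) : Finset τ :=
  (R.filter fun w => label w = S ∧ owner w = u).image slot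

variable {G label}

lemma slots_mono {owner : V → U} {slot : V → τ} {R R' : Finset V} (h : R ⊆ R') (S : κ) (u : U) :
    slots label owner slot R S u ⊆ slots label owner slot R' S u := by
  classical
  exact Finset.image_subset_image (Finset.filter_subset_filter _ h)

/-- If the vertices of one label and one owner form a complete multipartite graph whose parts are
the slots, and vertices of one label with different owners are not adjacent, then the number of
classes of a greedy constrained coloring is at most the sum over the labels of the largest number
of slots of an owner. -/
lemma GreedyRun.length_le [DecidableEq V] [Fintype κ] [Fintype U] {owner : V → U} {slot : V → τ}
    (hG : ∀ v w, label v = label w → (G.Adj v w ↔ owner v = owner w ∧ slot v ≠ slot w))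
    {R : Finset V} {cls : List (Finset V)} (h : GreedyRun G label R cls) :
    cls.length ≤ ∑ S, Finset.univ.sup fun u => (slots label owner slot R S u).card := by
  classical
  induction h with
  | done => simp
  | step R v σ cls hv hσ hrest ih =>
    set I := greedyScan G label v σ with hI
    obtain ⟨k4, k1, k2, k3⟩ := greedyScan_spec G label v σ
    have hvI : v ∈ I := mem_greedyScan_self G label v σ
    rw [← hI] at k1 k2 k3 k4
    have hmax : ∀ w ∈ R, label w = label v → (∀ x ∈ I, ¬ G.Adj x w) → w ∈ I := by
      intro w hw hl hadj
      by_cases hwv : w = v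
      · rwa [hwv]
      · exact k3 w ((hσ w).2 (Finset.mem_erase.2 ⟨hwv, hw⟩)) hl hadj
    -- Each class uses up one slot of every owner that still has vertices of this label, not only of
    -- the owner of `v`.
    have hdrop : ∀ u, (slots label owner slot (R \ I) (label v) u).card ≤
        (slots label owner slot R (label v) u).card - 1 := by
      intro u
      rcases (slots label owner slot R (label v) u).eq_empty_or_nonempty with he | ⟨t, ht⟩
      · have := slots_mono (label := label) (owner := owner) (slot := slot)
          (Finset.sdiff_subset (s := R) (t := I)) (label v) u
        rw [he] at this
        rw [Finset.subset_empty.1 this]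
        simp
      · have hx : ∃ x ∈ I, owner x = u := by
          by_contra! hno
          simp only [slots, Finset.mem_image, Finset.mem_filter] at ht
          obtain ⟨w, ⟨hwR, hwl, hwu⟩, -⟩ := ht
          refine hno w (hmax w hwR hwl fun x hxI hadj => ?_) hwu
          exact hno x hxI ((((hG x w ((k1 x hxI).trans hwl.symm)).1 hadj).1).trans hwu)
        obtain ⟨x, hxI, hxu⟩ := hx
        -- The slot of `x` disappears entirely: a vertex in the same slot has the same neighbors as
        -- `x` within the label, so maximality puts it in `I` as well.
        have hsub : slots label owner slot (R \ I) (label v) u ⊆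
            (slots label owner slot R (label v) u).erase (slot x) := by
          intro s hs
          refine Finset.mem_erase.2 ⟨?_, slots_mono Finset.sdiff_subset _ _ hs⟩
          rintro rfl
          simp only [slots, Finset.mem_image, Finset.mem_filter, Finset.mem_sdiff] at hs
          obtain ⟨w, ⟨⟨hwR, hwI⟩, hwl, hwu⟩, hws⟩ := hs
          refine hwI (hmax w hwR hwl fun y hyI hadj => ?_)
          have h1 := (hG y w ((k1 y hyI).trans hwl.symm)).1 hadj
          refine k2 y hyI x hxI ((hG y x ((k1 y hyI).trans (k1 x hxI).symm)).2
            ⟨h1.1.trans (hwu.trans hxu.symm), ?_⟩)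
          rw [← hws]
          exact h1.2
        have hxR : x ∈ R := by
          rcases k4 x hxI with rfl | h
          · exact hv
          · exact Finset.mem_of_mem_erase ((hσ x).1 h)
        have hxs : slot x ∈ slots label owner slot R (label v) u := by
          simp only [slots, Finset.mem_image, Finset.mem_filter]
          exact ⟨x, ⟨hxR, k1 x hxI, hxu⟩, rfl⟩
        rw [← Finset.card_erase_of_mem hxs]
        exact Finset.card_le_card hsub
    rw [List.length_cons]
    refine Nat.succ_le_of_lt (lt_of_le_of_lt ih ?_)
    refine Finset.sum_lt_sum (fun S _ => Finset.sup_mono_fun fun u _ =>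
      Finset.card_le_card (slots_mono Finset.sdiff_subset S u)) ⟨label v, Finset.mem_univ _, ?_⟩
    -- The slot of `v` makes the maximum positive, so the truncated subtraction of 1 is a strict
    -- decrease.
    have hpos : 0 < (slots label owner slot R (label v) (owner v)).card :=
      Finset.card_pos.2 ⟨slot v, Finset.mem_image.2
        ⟨v, Finset.mem_filter.2 ⟨hv, rfl, rfl⟩, rfl⟩⟩
    have hle : ∀ u, (slots label owner slot R (label v) u).card ≤
        Finset.univ.sup fun u => (slots label owner slot R (label v) u).card := fun u =>
      Finset.le_sup (f := fun u => (slots label owner slot R (label v) u).card)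
        (Finset.mem_univ u)
    have hsup : (Finset.univ.sup fun u => (slots label owner slot (R \ I) (label v) u).card) ≤
        (Finset.univ.sup fun u => (slots label owner slot R (label v) u).card) - 1 :=
      Finset.sup_le fun u _ => (hdrop u).trans (Nat.sub_le_sub_right (hle u) 1)
    have := hle (owner v)
    omega

end Greedy

/-! ### From color classes to pattern counts. -/

section Coloring

variable {n m M L : ℕ}

/-- The slot of a vertex among the requests of its user: its index if the packet is missing from
the cache of the user, and one common slot for all the cached requests. -/
def slotOf (C : Placement n m M) (d : Demand n m L) (v : Vertex n L) : Option (Fin L) :=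
  if packet d v ∈ (C (user v)).1 then none else some v.2

lemma mem_userLabel {C : Placement n m M} {d : Demand n m L} {v : Vertex n L} {w : Fin n} :
    w ∈ userLabel C d v ↔ w = user v ∨ packet d v ∈ (C w).1 := by
  simp [userLabel]

/-- If the users differ, each belongs to the label of the other vertex and so caches its packet,
which excludes both edges. For one user, distinct packets conflict as soon as one of them is missing
from the cache. -/
lemma adj_iff_of_userLabel_eq (C : Placement n m M) (d : Demand n m L) (v w : Vertex n L)
    (h : userLabel C d v = userLabel C d w) :
    (conflictGraph C d).toSimpleGraphInclusive.Adj v w ↔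
      user v = user w ∧ slotOf C d v ≠ slotOf C d w := by
  obtain ⟨u, l⟩ := v
  obtain ⟨u', l'⟩ := w
  simp only [Digraph.toSimpleGraphInclusive, SimpleGraph.fromRel_adj, conflictGraph, Interferes,
    slotOf, user, packet] at *
  by_cases huu : u = u'
  · subst huu
    have hinj : d u l = d u l' ↔ l = l' := (d u).injective.eq_iff
    by_cases h1 : d u l ∈ (C u).1 <;> by_cases h2 : d u l' ∈ (C u).1 <;>
      simp [h1, h2, hinj, eq_comm] <;> grind
  · have h1 : u ∈ userLabel C d (u', l') := h ▸ Finset.mem_insert_self _ _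
    have h2 : u' ∈ userLabel C d (u, l) := h.symm ▸ Finset.mem_insert_self _ _
    rw [mem_userLabel] at h1 h2
    have h1 := h1.resolve_left huu
    have h2 := h2.resolve_left (Ne.symm huu)
    simp only [packet] at h1 h2
    simp [huu, h1, h2]

/-- The number of requests of the user `u` whose packet is cached exactly by the users in `T`. -/
def patternCount (C : Placement n m M) (d : Demand n m L) (u : Fin n) (T : Finset (Fin n)) : ℕ :=
  (Finset.univ.filter fun l => ∀ w, d u l ∈ (C w).1 ↔ w ∈ T).card

/-- The 1 is the common slot `none` of the cached requests. A missing packet with label `S` is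
cached exactly by `S.erase u`. -/
lemma card_slots_le (C : Placement n m M) (d : Demand n m L) (S : Finset (Fin n)) (u : Fin n) :
    (slots (userLabel C d) user (slotOf C d) Finset.univ S u).card ≤
      1 + patternCount C d u (S.erase u) := by
  classical
  have hsub : slots (userLabel C d) user (slotOf C d) Finset.univ S u ⊆
      insert none ((Finset.univ.filter fun l => ∀ w, d u l ∈ (C w).1 ↔ w ∈ S.erase u).image
        some) := by
    intro s hs
    simp only [slots, Finset.mem_image, Finset.mem_filter, Finset.mem_univ, true_and] at hs
    obtain ⟨⟨u', l⟩, ⟨hl, hu⟩, rfl⟩ := hs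
    simp only [user] at hu
    subst hu
    by_cases hc : d u' l ∈ (C u').1
    · simp [slotOf, user, packet, hc]
    · refine Finset.mem_insert_of_mem (Finset.mem_image.2 ⟨l, ?_, by
        simp [slotOf, user, packet, hc]⟩)
      simp only [Finset.mem_filter, Finset.mem_univ, true_and]
      intro w
      rw [← hl]
      by_cases hw : w = u'
      · subst hw; simp [hc]
      · simp [mem_userLabel, user, packet, hw]
  refine (Finset.card_le_card hsub).trans ((Finset.card_insert_le _ _).trans ?_)
  rw [add_comm]
  exact Nat.add_le_add_left Finset.card_image_le _

lemma slots_eq_empty (C : Placement n m M) (d : Demand n m L) {S : Finset (Fin n)} {u : Fin n}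
    (hu : u ∉ S) : slots (userLabel C d) user (slotOf C d) Finset.univ S u = ∅ := by
  classical
  simp only [slots, Finset.image_eq_empty, Finset.filter_eq_empty_iff]
  rintro v - ⟨rfl, rfl⟩
  exact hu (Finset.mem_insert_self _ _)

/-- The `+ 1` allows for the default index `cls.length` of a vertex in no class, so it is not needed
that the classes cover the graph. -/
lemma localColors_colorOf_le {V : Type*} [Fintype V] [DecidableEq V] (H : Digraph V)
    (cls : List (Finset V)) : localColors H (colorOf cls) ≤ cls.length + 1 := by
  classical
  refine Finset.sup_le fun v _ => ?_
  rw [← Finset.card_range (cls.length + 1)]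
  refine Finset.card_le_card fun i hi => ?_
  simp only [Finset.mem_image] at hi
  obtain ⟨w, -, rfl⟩ := hi
  exact Finset.mem_range.2 (Nat.lt_succ_of_le List.findIdx_le_length)

lemma localColors_le_card {V κ : Type*} [Fintype V] (H : Digraph V) (c : V → κ) :
    localColors H c ≤ Fintype.card V := by
  classical
  exact Finset.sup_le fun v _ => Finset.card_image_le.trans (Finset.card_le_univ _)

lemma gclc_le_mul (C : Placement n m M) (d : Demand n m L) (cls : List (Finset (Vertex n L))) :
    (gclc C d cls : ℝ) ≤ L * n := by
  have h : gclc C d cls ≤ n * L :=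
    (min_le_left _ _).trans ((localColors_le_card _ _).trans (by simp))
  rw [mul_comm]
  exact_mod_cast h

/-- The number of transmissions is bounded by the total size of thresholds `a S` for the pattern
counts, plus the total excess of the counts over the thresholds. -/
lemma gclc_le_excess (C : Placement n m M) (d : Demand n m L) (cls : List (Finset (Vertex n L)))
    (h : IsConstrainedColoring C d cls) (a : Finset (Fin n) → ℝ)
    (ha : ∀ S, S.Nonempty → 0 ≤ a S) :
    (gclc C d cls : ℝ) ≤ 1 + ∑ S ∈ Finset.univ.filter (fun S : Finset (Fin n) => S.Nonempty),
      (1 + a S + ∑ u ∈ S, max 0 ((patternCount C d u (S.erase u) : ℝ) - a S)) := by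
  classical
  have h1 : gclc C d cls ≤ cls.length + 1 := (min_le_left _ _).trans (localColors_colorOf_le _ _)
  have h2 := GreedyRun.length_le (adj_iff_of_userLabel_eq C d) h
  have h3 : (gclc C d cls : ℝ) ≤ 1 + ∑ S : Finset (Fin n), ((Finset.univ.sup fun u =>
      (slots (userLabel C d) user (slotOf C d) Finset.univ S u).card : ℕ) : ℝ) := by
    rw [add_comm]
    exact_mod_cast h1.trans (Nat.add_le_add_right h2 1)
  refine h3.trans (add_le_add_right ?_ 1)
  rw [Finset.sum_filter]
  refine Finset.sum_le_sum fun S _ => ?_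
  split_ifs with hS
  · have hnn : ∀ u ∈ S, 0 ≤ max 0 ((patternCount C d u (S.erase u) : ℝ) - a S) :=
      fun u _ => le_max_left _ _
    have hSn : (Finset.univ : Finset (Fin n)).Nonempty := ⟨hS.choose, Finset.mem_univ _⟩
    -- The excess of a maximizing user is one term of the nonnegative sum over all users of `S`.
    obtain ⟨u, -, hu⟩ := Finset.exists_mem_eq_sup Finset.univ hSn fun u =>
      (slots (userLabel C d) user (slotOf C d) Finset.univ S u).card
    rw [hu]
    by_cases huS : u ∈ S
    · have e1 : ((slots (userLabel C d) user (slotOf C d) Finset.univ S u).card : ℝ) ≤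
          1 + patternCount C d u (S.erase u) := by exact_mod_cast card_slots_le C d S u
      have e2 := Finset.single_le_sum hnn huS
      have e3 := le_max_right 0 ((patternCount C d u (S.erase u) : ℝ) - a S)
      linarith
    · rw [slots_eq_empty C d huS]
      have := Finset.sum_nonneg hnn
      have := ha S hS
      simp only [Finset.card_empty, Nat.cast_zero]
      linarith
  · rw [Finset.not_nonempty_iff_eq_empty] at hS
    subst hS
    have : (Finset.univ.sup fun u =>
        (slots (userLabel C d) user (slotOf C d) Finset.univ ∅ u).card) = 0 :=
      Nat.le_zero.1 (Finset.sup_le fun u _ => by rw [slots_eq_empty C d (by simp)]; simp)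
    rw [this]; simp

end Coloring
end SharedLink

namespace SharedLink

/-! ### Exponential moments of the pattern counts. -/

section Moments

/-- Removing one file from `k + 1 ≤ m` multiplies the number of `M`-subsets by `1 - M / (k + 1)`, at
most `1 - M / m`. This is how sampling without replacement is compared with independent sampling. -/
lemma choose_sub_le {m M : ℕ} (hM : M ≤ m) {b : ℕ} (hb : b ≤ m) :
    ((m - b).choose M : ℝ) ≤ (1 - (M : ℝ) / m) ^ b * (m.choose M : ℝ) := by
  induction b with
  | zero => simp
  | succ b ih =>
    have hm : (0 : ℝ) < m := by exact_mod_cast (Nat.succ_pos b).trans_le hb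
    have hp : 0 ≤ 1 - (M : ℝ) / m := by
      rw [sub_nonneg, div_le_one hm]
      exact_mod_cast hM
    obtain ⟨k, hk⟩ : ∃ k, m - b = k + 1 := ⟨m - b - 1, by omega⟩
    have hk' : m - (b + 1) = k := by omega
    have hkm : k + 1 ≤ m := by omega
    have ih := ih (by omega)
    rw [hk] at ih
    rw [hk', pow_succ', mul_assoc]
    refine le_trans ?_ (mul_le_mul_of_nonneg_left ih hp)
    rcases lt_or_ge k M with hkM | hkM
    · rw [Nat.choose_eq_zero_of_lt hkM, Nat.cast_zero]
      positivity
    · have h := Nat.choose_mul_succ_eq k M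
      have h' : (k.choose M : ℝ) * (k + 1) = ((k + 1).choose M : ℝ) * (k + 1 - M) := by
        rw [← Nat.cast_inj (R := ℝ)] at h
        push_cast [Nat.cast_sub (show M ≤ k + 1 by omega)] at h
        exact h
      have hk0 : (0 : ℝ) < (k : ℝ) + 1 := by positivity
      have hkm' : (k : ℝ) + 1 ≤ m := by exact_mod_cast hkm
      have e : (k.choose M : ℝ) = (1 - M / ((k : ℝ) + 1)) * ((k + 1).choose M : ℝ) := by
        field_simp
        linarith
      rw [e]
      refine mul_le_mul_of_nonneg_right ?_ (Nat.cast_nonneg _)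
      gcongr

variable {n m M L : ℕ}

lemma card_avoiding (B : Finset (Fin m)) :
    (Finset.univ.filter fun c : {s : Finset (Fin m) // s.card = M} => ∀ x ∈ B, x ∉ c.1).card =
      (m - B.card).choose M := by
  have : m - B.card = (Bᶜ).card := by simp [Finset.card_compl]
  rw [this, ← Finset.card_powersetCard]
  refine Finset.card_bij (fun c _ => c.1) ?_ (fun a _ b _ h => Subtype.ext h) ?_
  · intro c hc
    refine Finset.mem_powersetCard.2 ⟨fun x hx => ?_, c.2⟩
    rw [Finset.mem_compl]
    exact fun hB => (Finset.mem_filter.1 hc).2 x hB hx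
  · intro s hs
    rw [Finset.mem_powersetCard] at hs
    refine ⟨⟨s, hs.2⟩, Finset.mem_filter.2 ⟨Finset.mem_univ _, fun x hx hxs => ?_⟩, rfl⟩
    exact Finset.mem_compl.1 (hs.1 hxs) hx

lemma card_containing (hM : M ≤ m) (B : Finset (Fin m)) :
    (Finset.univ.filter fun c : {s : Finset (Fin m) // s.card = M} => ∀ x ∈ B, x ∈ c.1).card =
      (m - B.card).choose (m - M) := by
  rw [← card_avoiding (M := m - M) B]
  refine Finset.card_bij (fun c _ => ⟨c.1ᶜ, by rw [Finset.card_compl, c.2, Fintype.card_fin]⟩) ?_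
    (fun a _ b _ h => Subtype.ext (compl_injective (Subtype.ext_iff.1 h))) ?_
  · intro c hc
    simpa using hc
  · intro s hs
    refine ⟨⟨s.1ᶜ, by rw [Finset.card_compl, s.2, Fintype.card_fin]; omega⟩, ?_, ?_⟩
    · simpa using hs
    · exact Subtype.ext (compl_compl _)

/-- The probability that a file set of size `b` is contained in a cache is at most `(M / m) ^ b`,
and the probability that it avoids the cache is at most `(1 - M / m) ^ b`. -/
lemma card_cache_pattern_le (hM : M ≤ m) (hm : 0 < m) (B : Finset (Fin m)) (P : Prop)
    [Decidable P] :
    ((Finset.univ.filter fun c : {s : Finset (Fin m) // s.card = M} =>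
      ∀ x ∈ B, (x ∈ c.1 ↔ P)).card : ℝ) ≤
      (if P then (M : ℝ) / m else 1 - (M : ℝ) / m) ^ B.card * (m.choose M : ℝ) := by
  have hB : B.card ≤ m := by simpa using B.card_le_univ
  have hm' : (m : ℝ) ≠ 0 := by exact_mod_cast hm.ne'
  split_ifs with hP
  · simp only [hP, iff_true]
    rw [card_containing hM, ← Nat.choose_symm hM]
    convert choose_sub_le (Nat.sub_le m M) hB using 3
    rw [Nat.cast_sub hM]
    field_simp
    ring
  · simp only [hP, iff_false]
    rw [card_avoiding]
    exact choose_sub_le hM hB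

lemma card_placement (n m M : ℕ) :
    Fintype.card (Placement n m M) = (m.choose M) ^ n := by
  simp [Placement]

lemma card_placement_pos (hM : M ≤ m) : (0 : ℝ) < Fintype.card (Placement n m M) := by
  rw [card_placement]
  exact_mod_cast pow_pos (Nat.choose_pos hM) n

/-- The event is a product over the users, whose caches are independent: caches in `T` contain the
`A.card` distinct files, and the others avoid them. -/
lemma card_placement_pattern_le (hM : M ≤ m) (hm : 0 < m) (d : Demand n m L) (u : Fin n)
    (T : Finset (Fin n)) (A : Finset (Fin L)) :
    ((Finset.univ.filter fun C : Placement n m M =>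
      ∀ l ∈ A, ∀ w, d u l ∈ (C w).1 ↔ w ∈ T).card : ℝ) ≤
      (((M : ℝ) / m) ^ T.card * (1 - (M : ℝ) / m) ^ (n - T.card)) ^ A.card *
        Fintype.card (Placement n m M) := by
  classical
  have hset : (Finset.univ.filter fun C : Placement n m M =>
      ∀ l ∈ A, ∀ w, d u l ∈ (C w).1 ↔ w ∈ T) =
      Fintype.piFinset fun w => Finset.univ.filter fun c : {s : Finset (Fin m) // s.card = M} =>
        ∀ x ∈ A.map (d u), (x ∈ c.1 ↔ w ∈ T) := by
    ext C
    simp only [Finset.mem_filter, Finset.mem_univ, true_and, Fintype.mem_piFinset, Finset.mem_map,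
      forall_exists_index, and_imp, forall_apply_eq_imp_iff₂]
    exact ⟨fun h w l hl => h l hl w, fun h l hl w => h w l hl⟩
  rw [hset, Fintype.card_piFinset, Nat.cast_prod]
  refine (Finset.prod_le_prod (fun _ _ => Nat.cast_nonneg _) fun w _ =>
    card_cache_pattern_le hM hm _ (w ∈ T)).trans (le_of_eq ?_)
  rw [Finset.prod_mul_distrib, Finset.prod_pow, Finset.card_map, Finset.prod_const,
    Finset.card_univ, Fintype.card_fin, card_placement, Nat.cast_pow]
  congr 2
  rw [Finset.prod_ite, Finset.prod_const, Finset.prod_const]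
  congr 2
  · simp
  · rw [Finset.filter_not, Finset.card_sdiff]
    simp

/-- Expanding the product over requests leaves only joint probabilities to bound. For `x ≥ 0` upper
bounds suffice, although the requests are not independent. -/
lemma one_add_pow_patternCount (x : ℝ) (C : Placement n m M) (d : Demand n m L) (u : Fin n)
    (T : Finset (Fin n)) :
    (1 + x) ^ patternCount C d u T = ∑ A : Finset (Fin L),
      if ∀ l ∈ A, ∀ w, d u l ∈ (C w).1 ↔ w ∈ T then x ^ A.card else 0 := by
  classical
  have h : (1 + x) ^ patternCount C d u T =
      ∏ l : Fin L, (1 + if ∀ w, d u l ∈ (C w).1 ↔ w ∈ T then x else 0) := by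
    rw [patternCount, ← Finset.prod_const, Finset.prod_filter]
    exact Finset.prod_congr rfl fun l _ => by split_ifs <;> simp
  rw [h, Finset.prod_one_add, Finset.powerset_univ]
  refine Finset.sum_congr rfl fun A _ => ?_
  rw [Finset.prod_ite_zero, Finset.prod_const]
  congr

/-- A binomial-type bound on the generating function of a pattern count under scalar uniform
placement. -/
lemma placementMean_one_add_pow_le (hM : M ≤ m) (hm : 0 < m) {x : ℝ} (hx : 0 ≤ x)
    (d : Demand n m L) (u : Fin n) (T : Finset (Fin n)) :
    placementMean (fun C : Placement n m M => (1 + x) ^ patternCount C d u T) ≤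
      (1 + x * (((M : ℝ) / m) ^ T.card * (1 - (M : ℝ) / m) ^ (n - T.card))) ^ L := by
  classical
  have hc : (0 : ℝ) < Fintype.card (Placement n m M) := card_placement_pos hM
  rw [placementMean, div_le_iff₀ hc]
  simp only [one_add_pow_patternCount]
  rw [Finset.sum_comm]
  set q := ((M : ℝ) / m) ^ T.card * (1 - (M : ℝ) / m) ^ (n - T.card) with hq
  have hR : (1 + x * q) ^ L = ∑ A : Finset (Fin L), (x * q) ^ A.card := by
    have := Finset.prod_one_add (f := fun _ : Fin L => x * q) Finset.univ
    simpa using this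
  rw [hR, Finset.sum_mul]
  refine Finset.sum_le_sum fun A _ => ?_
  rw [← Finset.sum_filter, Finset.sum_const, nsmul_eq_mul, mul_pow, mul_assoc, mul_comm]
  exact mul_le_mul_of_nonneg_left (card_placement_pattern_le hM hm d u T A) (by positivity)

/-- The mean excess of a pattern count over a multiple of its mean. -/
lemma placementMean_excess_le (hM : M ≤ m) (hm : 0 < m) {ε : ℝ} (hε : 0 < ε)
    (d : Demand n m L) (u : Fin n) (T : Finset (Fin n)) {q : ℝ}
    (hq : q = ((M : ℝ) / m) ^ T.card * (1 - (M : ℝ) / m) ^ (n - T.card)) :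
    placementMean (fun C : Placement n m M =>
        max 0 ((patternCount C d u T : ℝ) - (1 + ε) * (L * q))) ≤
      Real.exp (-(((1 + ε) * Real.log (1 + ε) - ε) * (L * q))) / Real.log (1 + ε) := by
  have hc : (0 : ℝ) < Fintype.card (Placement n m M) := card_placement_pos hM
  have hlog : 0 < Real.log (1 + ε) := Real.log_pos (by linarith)
  have h1 := placementMean_one_add_pow_le hM hm hε.le d u T
  rw [← hq] at h1
  set t := Real.log (1 + ε) with ht
  have hexp : Real.exp t = 1 + ε := Real.exp_log (by linarith)
  set a := (1 + ε) * (L * q) with ha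
  -- This is `max 0 s ≤ exp (t * s) / t` with the Chernoff-optimal `t = log (1 + ε)`.
  have hpt : ∀ C : Placement n m M, max 0 ((patternCount C d u T : ℝ) - a) ≤
      (1 + ε) ^ patternCount C d u T * (Real.exp (-(t * a)) / t) := by
    intro C
    have e1 : (1 + ε) ^ patternCount C d u T * (Real.exp (-(t * a)) / t) =
        Real.exp (t * ((patternCount C d u T : ℝ) - a)) / t := by
      rw [← hexp, ← Real.exp_nat_mul, ← mul_div_assoc, ← Real.exp_add]
      ring_nf
    rw [e1, le_div_iff₀ hlog]
    rcases le_total ((patternCount C d u T : ℝ) - a) 0 with h | h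
    · rw [max_eq_left h, zero_mul]
      positivity
    · rw [max_eq_right h, mul_comm]
      linarith [Real.add_one_le_exp (t * ((patternCount C d u T : ℝ) - a))]
  have hq0 : 0 ≤ q := by
    rw [hq]
    have : (M : ℝ) / m ≤ 1 := div_le_one_of_le₀ (by exact_mod_cast hM) (Nat.cast_nonneg _)
    have : 0 ≤ 1 - (M : ℝ) / m := by linarith
    positivity
  have h2 : (1 + ε * q) ^ L ≤ Real.exp (ε * (L * q)) := by
    calc (1 + ε * q) ^ L ≤ Real.exp (ε * q) ^ L := by
          gcongr
          linarith [Real.add_one_le_exp (ε * q)]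
      _ = Real.exp (ε * (L * q)) := by
          rw [← Real.exp_nat_mul]
          ring_nf
  calc placementMean (fun C : Placement n m M => max 0 ((patternCount C d u T : ℝ) - a))
      ≤ placementMean (fun C : Placement n m M => (1 + ε) ^ patternCount C d u T) *
          (Real.exp (-(t * a)) / t) := by
        rw [placementMean, placementMean, div_mul_eq_mul_div, Finset.sum_mul]
        gcongr
        exact hpt _
    _ ≤ Real.exp (ε * (L * q)) * (Real.exp (-(t * a)) / t) := by
        gcongr
        exact h1.trans h2
    _ = _ := by
        rw [← mul_div_assoc, ← Real.exp_add, ha]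
        ring_nf

end Moments
end SharedLink

namespace SharedLink

/-! ### Rate bound for finite parameters. -/

section Rate

variable {n m M L : ℕ}

lemma placementMean_le_add (hM : M ≤ m) {f g : Placement n m M → ℝ} {b : ℝ}
    (h : ∀ C, f C ≤ b + g C) : placementMean f ≤ b + placementMean g := by
  have hc := card_placement_pos (n := n) hM
  rw [placementMean, placementMean, div_le_iff₀ hc, add_mul, div_mul_cancel₀ _ hc.ne']
  refine (Finset.sum_le_sum fun C _ => h C).trans (le_of_eq ?_)
  rw [Finset.sum_add_distrib, Finset.sum_const, Finset.card_univ, nsmul_eq_mul, mul_comm]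

lemma placementMean_sum_mul {ι : Type*} (s : Finset ι) (w : ι → ℝ)
    (f : ι → Placement n m M → ℝ) :
    placementMean (fun C => ∑ i ∈ s, w i * f i C) = ∑ i ∈ s, w i * placementMean (f i) := by
  simp only [placementMean]
  rw [Finset.sum_comm, Finset.sum_div]
  refine Finset.sum_congr rfl fun i _ => ?_
  rw [← Finset.mul_sum, mul_div_assoc]

lemma placementMean_sum {ι : Type*} (s : Finset ι) (f : ι → Placement n m M → ℝ) :
    placementMean (fun C => ∑ i ∈ s, f i C) = ∑ i ∈ s, placementMean (f i) := by
  simpa using placementMean_sum_mul s (fun _ => 1) f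

/-- Markov's inequality for scalar uniform placement. -/
lemma one_sub_placementMean_le_prob (hM : M ≤ m) {E : Placement n m M → Prop}
    {W : Placement n m M → ℝ} (hW : ∀ C, 0 ≤ W C) (h : ∀ C, ¬ E C → 1 ≤ W C) :
    1 - placementMean W ≤ placementProb E := by
  classical
  have hc := card_placement_pos (n := n) hM
  have h1 : ((Finset.univ.filter fun C => ¬ E C).card : ℝ) ≤ ∑ C, W C := by
    rw [Finset.cast_card, Finset.sum_filter]
    refine Finset.sum_le_sum fun C _ => ?_
    by_cases hC : E C
    · simpa [hC] using hW C
    · simpa [hC] using h C hC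
  have h2 : ((Finset.univ.filter E).card : ℝ) + (Finset.univ.filter fun C => ¬ E C).card =
      Fintype.card (Placement n m M) := by
    exact_mod_cast Finset.card_filter_add_card_filter_not (s := Finset.univ) E
  have h3 : placementProb E = ((Finset.univ.filter E).card : ℝ) /
      Fintype.card (Placement n m M) := by
    rw [placementProb]
  rw [h3, placementMean, le_div_iff₀ hc, sub_mul, div_mul_cancel₀ _ hc.ne']
  linarith

lemma sum_toReal_pmf {α : Type*} [Fintype α] (Q : PMF α) : ∑ d, (Q d).toReal = 1 := by
  rw [← ENNReal.toReal_sum fun d _ => Q.apply_ne_top d, ← tsum_fintype (L := .unconditional _),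
    Q.tsum_coe, ENNReal.toReal_one]

lemma gclcRate_le_mul (Q : PMF (Demand n m L))
    (run : Placement n m M → Demand n m L → List (Finset (Vertex n L))) (C : Placement n m M) :
    gclcRate Q run C ≤ L * n := by
  calc gclcRate Q run C ≤ ∑ d, (Q d).toReal * ((L : ℝ) * n) :=
        Finset.sum_le_sum fun d _ =>
          mul_le_mul_of_nonneg_left (gclc_le_mul C d _) ENNReal.toReal_nonneg
    _ = L * n := by rw [← Finset.sum_mul, sum_toReal_pmf, one_mul]

/-- Each term is `(1 - p) / p` times the binomial weight of `S`, and the weights of all subsets sum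
to 1. -/
lemma sum_nonempty_pattern_le (n : ℕ) {p : ℝ} (hp : 0 < p) (hp1 : p ≤ 1) :
    ∑ S ∈ Finset.univ.filter (fun S : Finset (Fin n) => S.Nonempty),
      p ^ (S.card - 1) * (1 - p) ^ (n - (S.card - 1)) ≤ (1 - p) / p := by
  have h1 : (0 : ℝ) ≤ 1 - p := by linarith
  calc ∑ S ∈ Finset.univ.filter (fun S : Finset (Fin n) => S.Nonempty),
        p ^ (S.card - 1) * (1 - p) ^ (n - (S.card - 1))
      = ∑ S ∈ Finset.univ.filter (fun S : Finset (Fin n) => S.Nonempty),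
        (1 - p) / p * (p ^ S.card * (1 - p) ^ (n - S.card)) := by
        refine Finset.sum_congr rfl fun S hS => ?_
        have hpos : 0 < S.card := Finset.card_pos.2 (Finset.mem_filter.1 hS).2
        have hle : S.card ≤ n := by simpa using S.card_le_univ
        obtain ⟨s, hs⟩ : ∃ s, S.card = s + 1 := ⟨S.card - 1, by omega⟩
        obtain ⟨j, rfl⟩ : ∃ j, n = s + 1 + j := ⟨n - (s + 1), by omega⟩
        rw [hs, Nat.add_sub_cancel, Nat.add_sub_cancel_left,
          show s + 1 + j - s = j + 1 by omega]
        field_simp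
        ring
    _ ≤ ∑ S : Finset (Fin n), (1 - p) / p * (p ^ S.card * (1 - p) ^ (n - S.card)) :=
        Finset.sum_le_sum_of_subset_of_nonneg (Finset.filter_subset _ _)
          fun S _ _ => by positivity
    _ = (1 - p) / p := by
        rw [← Finset.mul_sum, Fin.sum_pow_mul_eq_add_pow]
        simp

lemma card_filter_nonempty (n : ℕ) :
    ((Finset.univ.filter fun S : Finset (Fin n) => S.Nonempty).card : ℝ) = 2 ^ n - 1 := by
  have h : (Finset.univ.filter fun S : Finset (Fin n) => S.Nonempty) =
      Finset.univ.erase ∅ := by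
    ext S
    simp [Finset.nonempty_iff_ne_empty]
  rw [h, Finset.card_erase_of_mem (Finset.mem_univ _), Finset.card_univ, Fintype.card_finset,
    Fintype.card_fin, Nat.cast_sub Nat.one_le_two_pow]
  simp

lemma two_pow_mul_exp_le (n : ℕ) {x : ℝ} (hx : 3 * n ≤ x) :
    (2 : ℝ) ^ n * (n * Real.exp (-x)) ≤ Real.exp (-n) := by
  have h2 : (2 : ℝ) ^ n ≤ Real.exp n := by
    have := Real.add_one_le_exp 1
    calc (2 : ℝ) ^ n ≤ Real.exp 1 ^ n := by gcongr; linarith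
      _ = Real.exp n := by rw [← Real.exp_nat_mul, mul_one]
  have hn : (n : ℝ) ≤ Real.exp n := by linarith [Real.add_one_le_exp (n : ℝ)]
  calc (2 : ℝ) ^ n * (n * Real.exp (-x)) ≤
        Real.exp n * (Real.exp n * Real.exp (-(3 * n))) := by gcongr
    _ = Real.exp (-n) := by
        rw [← Real.exp_add, ← Real.exp_add]
        ring_nf

/-- Positivity of the Chernoff exponent, from `log y < y - 1` at `y = (1 + ε)⁻¹`. -/
lemma mul_log_sub_pos {ε : ℝ} (hε : 0 < ε) : 0 < (1 + ε) * Real.log (1 + ε) - ε := by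
  have h := Real.log_lt_sub_one_of_pos (x := (1 + ε)⁻¹) (by positivity)
    (by rw [ne_eq, inv_eq_one]; linarith)
  rw [Real.log_inv] at h
  have h' : (1 + ε) * (1 + ε)⁻¹ = 1 := mul_inv_cancel₀ (by linarith)
  nlinarith

/-- Finite form of the rate bound: if every pattern count has mean at least `K * n`, then the rate
is at most `(1 + 2 * ε) * L * (m / M - 1)` in mean and with probability at least `1 - ε`. -/
lemma gclcRate_bounds (hM0 : 0 < M) (hMm : M < m) (hn : 1 ≤ n) {ε K : ℝ} (hε : 0 < ε)
    (hK : 3 ≤ ((1 + ε) * Real.log (1 + ε) - ε) * K) (hεK : 3 ≤ ε * K)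
    (hexp : Real.exp (-n) / Real.log (1 + ε) ≤ min ε 1)
    (hpat : ∀ t < n, K * n ≤ L * (((M : ℝ) / m) ^ t * (1 - (M : ℝ) / m) ^ (n - t)))
    (Q : PMF (Demand n m L))
    (run : Placement n m M → Demand n m L → List (Finset (Vertex n L)))
    (hrun : ∀ C d, IsConstrainedColoring C d (run C d)) :
    placementMean (gclcRate Q run) ≤ (1 + 2 * ε) * (L * ((m : ℝ) / M - 1)) ∧
      1 - ε ≤ placementProb fun C =>
        gclcRate Q run C ≤ (1 + 2 * ε) * (L * ((m : ℝ) / M - 1)) := by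
  have hm0 : 0 < m := hM0.trans hMm
  have hM0' : (0 : ℝ) < M := by exact_mod_cast hM0
  have hm0' : (0 : ℝ) < m := by exact_mod_cast hm0
  have hMm' : (M : ℝ) < m := by exact_mod_cast hMm
  have hlog : 0 < Real.log (1 + ε) := Real.log_pos (by linarith)
  have hp0 : 0 < (M : ℝ) / m := by positivity
  have hp1 : (M : ℝ) / m ≤ 1 := div_le_one_of_le₀ hMm'.le hm0'.le
  have hp1' : 0 ≤ 1 - (M : ℝ) / m := by linarith
  have hh := mul_log_sub_pos hε
  set h := (1 + ε) * Real.log (1 + ε) - ε with hh_def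
  set X := (L : ℝ) * ((m : ℝ) / M - 1) with hX
  set F := Finset.univ.filter fun S : Finset (Fin n) => S.Nonempty with hF
  set q : Finset (Fin n) → ℝ := fun S =>
    ((M : ℝ) / m) ^ (S.card - 1) * (1 - (M : ℝ) / m) ^ (n - (S.card - 1)) with hq
  have hq0 : ∀ S, 0 ≤ q S := fun S => by positivity
  have hqK : ∀ S ∈ F, K * n ≤ L * q S := fun S hS => by
    have hpos : 0 < S.card := Finset.card_pos.2 (Finset.mem_filter.1 hS).2
    have hle : S.card ≤ n := by simpa using S.card_le_univ
    exact hpat _ (by omega)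
  have hn' : (1 : ℝ) ≤ n := by exact_mod_cast hn
  have h2n : (2 : ℝ) ≤ 2 ^ n := by
    calc (2 : ℝ) = 2 ^ 1 := by norm_num
      _ ≤ 2 ^ n := pow_le_pow_right₀ (by norm_num) hn
  have hsumq : ∑ S ∈ F, L * q S ≤ X := by
    rw [← Finset.mul_sum]
    refine mul_le_mul_of_nonneg_left ((sum_nonempty_pattern_le n hp0 hp1).trans
      (le_of_eq ?_)) (Nat.cast_nonneg _)
    field_simp
  have hKpos : 0 < K := by
    by_contra! hneg
    nlinarith
  have hXlow : (2 ^ n - 1) * K ≤ X := by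
    calc (2 ^ n - 1) * K ≤ ∑ S ∈ F, K * (n : ℝ) := by
          rw [Finset.sum_const, nsmul_eq_mul, card_filter_nonempty]
          have : 0 ≤ K * ((n : ℝ) - 1) := mul_nonneg hKpos.le (by linarith)
          nlinarith
      _ ≤ ∑ S ∈ F, L * q S := Finset.sum_le_sum hqK
      _ ≤ X := hsumq
  -- The second `ε * X` in the bound pays for the extra colors, `2 ^ n` in all, and for an excess `W
  -- ≤ 1`. Here `3 * (2 ^ n - 1) ≥ 2 ^ n + 1` uses `n ≥ 1`.
  have hbase : (2 : ℝ) ^ n + 1 ≤ ε * X := by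
    have : ε * ((2 ^ n - 1) * K) ≤ ε * X := mul_le_mul_of_nonneg_left hXlow hε.le
    have : 3 * ((2 : ℝ) ^ n - 1) ≤ (ε * K) * (2 ^ n - 1) :=
      mul_le_mul_of_nonneg_right hεK (by linarith)
    nlinarith
  set a : Finset (Fin n) → ℝ := fun S => (1 + ε) * (L * q S) with ha
  set W : Placement n m M → ℝ := fun C => ∑ d, (Q d).toReal *
    ∑ S ∈ F, ∑ u ∈ S, max 0 ((patternCount C d u (S.erase u) : ℝ) - a S) with hW
  have hW0 : ∀ C, 0 ≤ W C := fun C => Finset.sum_nonneg fun d _ =>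
    mul_nonneg ENNReal.toReal_nonneg (Finset.sum_nonneg fun S _ => Finset.sum_nonneg fun u _ =>
      le_max_left _ _)
  have hrate : ∀ C, gclcRate Q run C ≤ (2 ^ n + (1 + ε) * X) + W C := by
    intro C
    have hpt : ∀ d, (gclc C d (run C d) : ℝ) ≤ (2 ^ n + (1 + ε) * X) +
        ∑ S ∈ F, ∑ u ∈ S, max 0 ((patternCount C d u (S.erase u) : ℝ) - a S) := by
      intro d
      refine (gclc_le_excess C d _ (hrun C d) a fun S _ =>
        mul_nonneg (by linarith) (mul_nonneg (Nat.cast_nonneg _) (hq0 S))).trans ?_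
      rw [Finset.sum_add_distrib, Finset.sum_add_distrib, Finset.sum_const, nsmul_eq_mul,
        card_filter_nonempty, ha, ← Finset.mul_sum]
      have := mul_le_mul_of_nonneg_left hsumq (show 0 ≤ 1 + ε by linarith)
      linarith
    calc gclcRate Q run C ≤ ∑ d, (Q d).toReal * ((2 ^ n + (1 + ε) * X) +
          ∑ S ∈ F, ∑ u ∈ S, max 0 ((patternCount C d u (S.erase u) : ℝ) - a S)) :=
          Finset.sum_le_sum fun d _ => mul_le_mul_of_nonneg_left (hpt d) ENNReal.toReal_nonneg
      _ = _ := by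
          simp only [mul_add, Finset.sum_add_distrib, ← Finset.sum_mul, sum_toReal_pmf, hW]
          ring
  have hmeanW : placementMean W ≤ Real.exp (-n) / Real.log (1 + ε) := by
    have hterm : ∀ d : Demand n m L, ∀ S ∈ F, ∀ u ∈ S, placementMean (fun C : Placement n m M =>
        max 0 ((patternCount C d u (S.erase u) : ℝ) - a S)) ≤
        Real.exp (-(h * (K * n))) / Real.log (1 + ε) := by
      intro d S hS u hu
      refine (placementMean_excess_le hMm.le hm0 hε d u (S.erase u) (q := q S) ?_).trans ?_
      · rw [Finset.card_erase_of_mem hu]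
      · exact div_le_div_of_nonneg_right (Real.exp_le_exp.2 (neg_le_neg
          (mul_le_mul_of_nonneg_left (hqK S hS) hh.le))) hlog.le
    rw [hW, placementMean_sum_mul]
    calc ∑ d, (Q d).toReal * placementMean (fun C : Placement n m M =>
          ∑ S ∈ F, ∑ u ∈ S, max 0 ((patternCount C d u (S.erase u) : ℝ) - a S))
        ≤ ∑ d, (Q d).toReal * (Real.exp (-n) / Real.log (1 + ε)) := by
          refine Finset.sum_le_sum fun d _ =>
            mul_le_mul_of_nonneg_left ?_ ENNReal.toReal_nonneg
          rw [placementMean_sum]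
          calc ∑ S ∈ F, placementMean (fun C : Placement n m M => ∑ u ∈ S,
                max 0 ((patternCount C d u (S.erase u) : ℝ) - a S))
              ≤ ∑ S ∈ F, n * (Real.exp (-(h * (K * n))) / Real.log (1 + ε)) := by
                refine Finset.sum_le_sum fun S hS => ?_
                rw [placementMean_sum]
                refine (Finset.sum_le_sum (hterm d S hS)).trans ?_
                rw [Finset.sum_const, nsmul_eq_mul]
                gcongr
                simpa using S.card_le_univ
            _ = (2 ^ n - 1) * (n * Real.exp (-(h * (K * n)))) / Real.log (1 + ε) := by
                rw [Finset.sum_const, nsmul_eq_mul, card_filter_nonempty]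
                ring
            _ ≤ Real.exp (-n) / Real.log (1 + ε) := by
                gcongr
                refine le_trans ?_ (two_pow_mul_exp_le n (x := h * (K * n)) ?_)
                · gcongr
                  linarith
                · rw [← mul_assoc]
                  gcongr
      _ = Real.exp (-n) / Real.log (1 + ε) := by
          rw [← Finset.sum_mul, sum_toReal_pmf, one_mul]
  -- The bound by 1 serves the mean; the bound by `ε` serves Markov's inequality for the event `1 ≤
  -- W`.
  have hW1 := hmeanW.trans hexp
  constructor
  · have := placementMean_le_add hMm.le hrate
    have := hW1.trans (min_le_right _ _)
    linarith
  · have h1 := one_sub_placementMean_le_prob hMm.le hW0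
      (E := fun C => gclcRate Q run C ≤ (1 + 2 * ε) * X) (fun C hC => by
        by_contra! hlt
        exact hC ((hrate C).trans (by linarith)))
    have := hW1.trans (min_le_left _ _)
    linarith

end Rate

/-! ### Growth condition and choice of a null sequence. -/

section Asymptotics

/-- The growth condition makes the mean of every pattern count at least `K * n`. -/
lemma le_pattern_mean_of_growth {n m M L : ℕ} (hM0 : 0 < M) (hMm : M < m) {K : ℝ}
    (hg : K * (if (M : ℝ) / m < 1 / 2
        then (n : ℝ) * M / m * ((m : ℝ) / M) ^ n * (1 / (1 - (M : ℝ) / m))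
        else (n : ℝ) * ((m : ℝ) / ((m : ℝ) - M)) ^ n) ≤ L) {t : ℕ} (ht : t < n) :
    K * n ≤ L * (((M : ℝ) / m) ^ t * (1 - (M : ℝ) / m) ^ (n - t)) := by
  have hM0' : (0 : ℝ) < M := by exact_mod_cast hM0
  have hMm' : (M : ℝ) < m := by exact_mod_cast hMm
  have hm0' : (0 : ℝ) < m := hM0'.trans hMm'
  have e1 : (m : ℝ) / M = ((M : ℝ) / m)⁻¹ := (inv_div _ _).symm
  have e2 : (m : ℝ) / ((m : ℝ) - M) = (1 - (M : ℝ) / m)⁻¹ := by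
    have : (m : ℝ) - M ≠ 0 := by linarith
    field_simp
  have hp1 : (M : ℝ) / m < 1 := (div_lt_one hm0').2 hMm'
  have hp0 : 0 < (M : ℝ) / m := by positivity
  rw [e1, e2, mul_div_assoc] at hg
  generalize (M : ℝ) / m = p at *
  have hr : 0 < 1 - p := by linarith
  obtain ⟨j, rfl⟩ : ∃ j, n = t + j + 1 := ⟨n - t - 1, by omega⟩
  rw [show t + j + 1 - t = j + 1 by omega]
  -- The smallest pattern probability over `t < n` occurs at `t = n - 1` if `p < 1 / 2` and at `t =
  -- 0` otherwise; the growth function is `n` divided by it.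
  split_ifs at hg with hp
  · calc K * ((t + j + 1 : ℕ) : ℝ)
        = K * (((t + j + 1 : ℕ) : ℝ) * p * p⁻¹ ^ (t + j + 1) * (1 / (1 - p))) *
          (p ^ t * (p ^ j * (1 - p))) := by
          rw [inv_pow]
          field_simp
          ring
      _ ≤ L * (p ^ t * ((1 - p) ^ j * (1 - p))) := by
          gcongr
          linarith
      _ = _ := by rw [pow_succ]
  · push Not at hp
    calc K * ((t + j + 1 : ℕ) : ℝ)
        = K * (((t + j + 1 : ℕ) : ℝ) * (1 - p)⁻¹ ^ (t + j + 1)) *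
          ((1 - p) ^ t * (1 - p) ^ (j + 1)) := by
          rw [inv_pow]
          field_simp
          ring
      _ ≤ L * (p ^ t * (1 - p) ^ (j + 1)) := by
          gcongr
          linarith

/-- A monotone family of properties which holds eventually for each positive parameter holds
eventually along some null sequence of parameters. -/
lemma exists_tendsto_zero_of_eventually {P : ℕ → ℝ → Prop}
    (hmono : ∀ k x y, x ≤ y → P k x → P k y) (h : ∀ ε > 0, ∀ᶠ k in atTop, P k ε) :
    ∃ δ : ℕ → ℝ, Tendsto δ atTop (𝓝 0) ∧ ∀ᶠ k in atTop, P k (δ k) := by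
  set A : ℕ → Set ℝ := fun k => {x | 0 < x ∧ P k x} with hA
  have hbdd : ∀ k, BddBelow (A k) := fun k => ⟨0, fun x hx => hx.1.le⟩
  -- The infimum need not be attained, so a vanishing positive term is added.
  refine ⟨fun k => sInf (A k) + 1 / ((k : ℝ) + 1), ?_, ?_⟩
  · have h0 : Tendsto (fun k => sInf (A k)) atTop (𝓝 0) := by
      rw [Metric.tendsto_nhds]
      intro ε hε
      filter_upwards [h (ε / 2) (by positivity)] with k hk
      have h1 : sInf (A k) ≤ ε / 2 := csInf_le (hbdd k) ⟨by positivity, hk⟩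
      have h2 : 0 ≤ sInf (A k) := Real.sInf_nonneg fun x hx => hx.1.le
      rw [Real.dist_eq, sub_zero, abs_of_nonneg h2]
      linarith
    simpa using h0.add tendsto_one_div_add_atTop_nhds_zero_nat
  · filter_upwards [h 1 one_pos] with k hk
    obtain ⟨x, hx, hlt⟩ := exists_lt_of_csInf_lt (s := A k) ⟨1, one_pos, hk⟩
      (lt_add_of_pos_right (sInf (A k)) (show 0 < 1 / ((k : ℝ) + 1) by positivity))
    exact hmono k x _ hlt.le hx.2

lemma placementProb_mono {n m M : ℕ} {E E' : Placement n m M → Prop} (h : ∀ C, E C → E' C) :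
    placementProb E ≤ placementProb E' := by
  unfold placementProb
  gcongr with C
  exact h C

end Asymptotics

end SharedLink

/-! ### Passage to the limit. -/

theorem theorem5 (n m M L : ℕ → ℕ)
    (hn : Tendsto n atTop atTop) (hm : Tendsto m atTop atTop)
    (hM : Tendsto M atTop atTop) (hL : Tendsto L atTop atTop)
    (hMm : ∀ᶠ k in atTop, M k < m k)
    (hML : (fun k => (L k : ℝ)) =o[atTop] fun k => (M k : ℝ))
    (hgrowth : (fun k => if (M k : ℝ) / m k < 1 / 2
        then (n k : ℝ) * M k / m k * ((m k : ℝ) / M k) ^ n k * (1 / (1 - (M k : ℝ) / m k))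
        else (n k : ℝ) * ((m k : ℝ) / ((m k : ℝ) - M k)) ^ n k)
      =o[atTop] fun k => (L k : ℝ)) :
    ∃ δ : ℕ → ℝ, Tendsto δ atTop (𝓝 0) ∧
      ∀ᶠ k in atTop, ∀ (Q : PMF (SharedLink.Demand (n k) (m k) (L k)))
        (run : SharedLink.Placement (n k) (m k) (M k) → SharedLink.Demand (n k) (m k) (L k) →
          List (Finset (SharedLink.Vertex (n k) (L k)))),
        (∀ C d, SharedLink.IsConstrainedColoring C d (run C d)) →
        SharedLink.placementMean (SharedLink.gclcRate Q run) ≤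
          (1 + δ k) * min ((L k : ℝ) * ((m k : ℝ) / M k - 1))
            (min ((L k : ℝ) * n k) ((m k : ℝ) - M k)) ∧
        1 - δ k ≤ SharedLink.placementProb fun C => SharedLink.gclcRate Q run C ≤
          (1 + δ k) * min ((L k : ℝ) * ((m k : ℝ) / M k - 1))
            (min ((L k : ℝ) * n k) ((m k : ℝ) - M k)) := by
  -- The inequalities on `M k` are part of the property because monotonicity in `x` needs the
  -- minimum to be nonnegative.
  have key := SharedLink.exists_tendsto_zero_of_eventually (P := fun k x => 0 < M k ∧ M k < m k ∧
    ∀ (Q : PMF (SharedLink.Demand (n k) (m k) (L k)))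
        (run : SharedLink.Placement (n k) (m k) (M k) → SharedLink.Demand (n k) (m k) (L k) →
          List (Finset (SharedLink.Vertex (n k) (L k)))),
        (∀ C d, SharedLink.IsConstrainedColoring C d (run C d)) →
        SharedLink.placementMean (SharedLink.gclcRate Q run) ≤
          (1 + x) * min ((L k : ℝ) * ((m k : ℝ) / M k - 1))
            (min ((L k : ℝ) * n k) ((m k : ℝ) - M k)) ∧
        1 - x ≤ SharedLink.placementProb fun C => SharedLink.gclcRate Q run C ≤
          (1 + x) * min ((L k : ℝ) * ((m k : ℝ) / M k - 1))
            (min ((L k : ℝ) * n k) ((m k : ℝ) - M k))) ?_ ?_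
  · obtain ⟨δ, h0, h1⟩ := key
    exact ⟨δ, h0, h1.mono fun k hk => hk.2.2⟩
  · rintro k x y hxy ⟨hM0, hlt, hb⟩
    refine ⟨hM0, hlt, fun Q run hrun => ?_⟩
    obtain ⟨b1, b2⟩ := hb Q run hrun
    have hM0' : (0 : ℝ) < M k := by exact_mod_cast hM0
    have hlt' : (M k : ℝ) < m k := by exact_mod_cast hlt
    have hX : 0 ≤ (m k : ℝ) / M k - 1 := by
      rw [sub_nonneg, one_le_div hM0']
      exact hlt'.le
    have hmin : 0 ≤ min ((L k : ℝ) * ((m k : ℝ) / M k - 1))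
        (min ((L k : ℝ) * n k) ((m k : ℝ) - M k)) :=
      le_min (by positivity) (le_min (by positivity) (by linarith))
    have hle := mul_le_mul_of_nonneg_right (add_le_add_right hxy 1) hmin
    exact ⟨b1.trans hle, (sub_le_sub_left hxy 1).trans
      (b2.trans (SharedLink.placementProb_mono fun C hC => hC.trans hle))⟩
  · intro x hx
    set ε := x / 2 with hε_def
    have hε : 0 < ε := by positivity
    have hlog : 0 < Real.log (1 + ε) := Real.log_pos (by linarith)
    have hh := SharedLink.mul_log_sub_pos hε
    obtain ⟨K, hK1, hK2⟩ : ∃ K, 3 ≤ ((1 + ε) * Real.log (1 + ε) - ε) * K ∧ 3 ≤ ε * K := by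
      refine ⟨max (3 / ((1 + ε) * Real.log (1 + ε) - ε)) (3 / ε), ?_, ?_⟩
      · rw [mul_comm, ← div_le_iff₀ hh]
        exact le_max_left _ _
      · rw [mul_comm, ← div_le_iff₀ hε]
        exact le_max_right _ _
    have hKpos : 0 < K := by
      by_contra! hneg
      nlinarith
    have hexp : ∀ᶠ k in atTop, Real.exp (-(n k : ℝ)) / Real.log (1 + ε) ≤ min ε 1 := by
      have h1 : Tendsto (fun k => Real.exp (-(n k : ℝ)) / Real.log (1 + ε)) atTop (𝓝 0) := by
        have := (Real.tendsto_exp_neg_atTop_nhds_zero.comp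
          (tendsto_natCast_atTop_atTop.comp hn)).div_const (Real.log (1 + ε))
        simpa using this
      exact h1.eventually_le_const (lt_min hε one_pos)
    have hLM := hML.def (c := 1) one_pos
    have hgr := hgrowth.def (c := K⁻¹) (by positivity)
    filter_upwards [hMm, hM.eventually_gt_atTop 0, hn.eventually_ge_atTop 1, hexp, hLM, hgr]
      with k hlt hM0 hn1 hexpk hLMk hgrk
    refine ⟨hM0, hlt, fun Q run hrun => ?_⟩
    have hM0' : (0 : ℝ) < M k := by exact_mod_cast hM0
    have hlt' : (M k : ℝ) < m k := by exact_mod_cast hlt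
    rw [one_mul, Real.norm_of_nonneg (Nat.cast_nonneg _),
      Real.norm_of_nonneg (Nat.cast_nonneg _)] at hLMk
    rw [Real.norm_of_nonneg (Nat.cast_nonneg (L k))] at hgrk
    have hg := mul_le_mul_of_nonneg_left ((le_abs_self _).trans hgrk) hKpos.le
    rw [mul_inv_cancel_left₀ hKpos.ne'] at hg
    obtain ⟨b1, b2⟩ := SharedLink.gclcRate_bounds hM0 hlt hn1 hε hK1 hK2 hexpk
      (fun t ht => SharedLink.le_pattern_mean_of_growth hM0 hlt hg ht) Q run hrun
    have hx2 : 2 * ε = x := by rw [hε_def]; ring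
    rw [hx2] at b1 b2
    -- The left side is `(L / M) * (m - M)`, and `L ≤ M` eventually.
    have hthird : (L k : ℝ) * ((m k : ℝ) / M k - 1) ≤ (m k : ℝ) - M k := by
      have : (m k : ℝ) / M k - 1 = ((m k : ℝ) - M k) / M k := by field_simp
      rw [this, ← mul_div_assoc, div_le_iff₀ hM0', mul_comm]
      exact mul_le_mul_of_nonneg_left hLMk (by linarith)
    have hLn : ∀ r : ℝ, r ≤ (1 + x) * ((L k : ℝ) * ((m k : ℝ) / M k - 1)) → r ≤ L k * n k →
        r ≤ (1 + x) * min ((L k : ℝ) * ((m k : ℝ) / M k - 1))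
          (min ((L k : ℝ) * n k) ((m k : ℝ) - M k)) := by
      intro r h1 h2
      rw [mul_min_of_nonneg _ _ (by linarith), mul_min_of_nonneg _ _ (by linarith)]
      have h3 : 0 ≤ x * ((L k : ℝ) * n k) := by positivity
      refine le_min h1 (le_min (by linarith) (h1.trans ?_))
      exact mul_le_mul_of_nonneg_left hthird (by linarith)
    refine ⟨hLn _ b1 ?_, ?_⟩
    · have := SharedLink.placementMean_le_add (n := n k) hlt.le (f := SharedLink.gclcRate Q run)
        (g := fun _ => 0) (b := L k * n k)
        (fun C => by simpa using SharedLink.gclcRate_le_mul Q run C)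
      simpa [SharedLink.placementMean] using this
    · have : 1 - x ≤ 1 - ε := by linarith
      exact this.trans (b2.trans (SharedLink.placementProb_mono fun C hC =>
        hLn _ hC (SharedLink.gclcRate_le_mul Q run C)))
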